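/- Consider the types of System F extended with finite sums, finite products and fixpoints, $$A,B ::= X \mid A\Rightarrow B \mid \forall X.A \mid 1 \mid 0 \mid A\times B \mid A+B \mid \mu X.A \mid \nu X.A ,$$ taken up to renaming of bound variables, where $\mu X.A$ and $\nu X.A$ are formed only if $X$ has only positive free occurrences in $A$. (An occurrence of a variable is positive or negative according to whether it lies to the left of an even or an odd number of arrows.) For a list $(A_i)_{i\in L}$ write $\langle A_i\rangle_{i\in L}\Rightarrow B$ for $A_{i_1}\Rightarrow\dots\Rightarrow A_{i_k}\Rightarrow B$; the empty product is $1$, the empty sum is $0$; and $\exists\vec Z.A$ stands for $\forall Y'.(\forall \vec Z.(A\Rightarrow Y'))\Rightarrow Y'$ if $\vec Z$ is non-empty and for $A$ if $\vec Z$ is empty. Let $\equiv_{\mathsf Y}$ be the least congruence on these types (that is, the least equivalence relation compatible with all type constructors) containing all instances of the following schemas. 1. $\beta\eta$-isomorphisms: - $A\Rightarrow(B\Rightarrow C)\equiv B\Rightarrow(A\Rightarrow C)$; $\ \forall X.\forall Y.A\equiv\forall Y.\forall X.A$; $\ A\equiv\forall X.A$ and $A\Rightarrow\forall X.B\equiv\forall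 X.(A\Rightarrow B)$ if $X$ is not free in $A$; - $A\times 1\equiv A$; $\ 1\Rightarrow A\equiv A$; $\ A\times(B\times C)\equiv(A\times B)\times C$; $\ A\times B\equiv B\times A$; $\ (A\times B)\Rightarrow C\equiv A\Rightarrow(B\Rightarrow C)$; $\ \forall X.(A\times B)\equiv(\forall X.A)\times(\forall X.B)$; - $A+0\equiv A$; $\ A\times 0\equiv 0$; $\ 0\Rightarrow A\equiv 1$; $\ A+(B+C)\equiv(A+B)+C$; $\ A+B\equiv B+A$; $\ A\times(B+C)\equiv(A\times B)+(A\times C)$; $\ (A+B)\Rightarrow C\equiv(A\Rightarrow C)\times(B\Rightarrow C)$; - $\mu X.A\equiv A$ and $\nu X.A\equiv A$ if $X$ is not free in $A$; $\ \mu X.A\equiv A[\mu X.A/X]$ and $\nu X.A\equiv A[\nu X.A/X]$. 2. Yoneda type isomorphisms, for finite, possibly empty, lists of indices $k$, $j$ and of variables $\vec Y,\vec Z_k$: $$\forall X.\forall\vec Y.\big\langle \forall\vec Z_k.\langle A_{jk}\rangle_j\Rightarrow X\big\rangle_k\Rightarrow B\ \equiv\ \forall\vec Y.\,B\big[\{\mu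 X.\}\textstyle\sum_k\exists\vec Z_k.\prod_j A_{jk}\,/\,X\big]$$ if $X$ has only positive free occurrences in all $A_{jk}$ and in $B$; and $$\forall X.\forall\vec Y.\big\langle \forall\vec Z_k.\,X\Rightarrow A_k\big\rangle_k\Rightarrow B\ \equiv\ \forall\vec Y.\,B\big[\{\nu X.\}\textstyle\prod_k\forall\vec Z_k.A_k\,/\,X\big]$$ if $X$ has only positive free occurrences in all $A_k$ and only negative free occurrences in $B$. Here $\{\mu X.\}$ (resp. $\{\nu X.\}$) means that the binder is present only if $X$ actually occurs free in some $A_{jk}$ (resp. $A_k$). A simple type is a type built from variables by $\Rightarrow$ only. It is inhabited if it is the type of a closed term of the simply typed $\lambda$-calculus. It is balanced if every variable occurring in it occurs exactly once positively and exactly once negatively, and negatively non-duplicated if no variable has two or more negative occurrences in it. **Proposition.** Let $A$ be an inhabited simple type whose free variables are among $X_1,\dots,X_n$. If $A$ is balanced or negatively non-duplicated, then $\forall X_1\dots\forall X_n.A\equiv_{\mathsf Y}1$. -/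

import Mathlib

/-! ### Types of System F with `0, 1, +, ×` and least/greatest fixpoints

Types are taken up to renaming of bound variables, in de Bruijn style: `var i` is the variable bound
by the `i`-th enclosing binder (counted from the inside); indices that exceed the number of enclosing
binders are free variables. -/

/-- Raw types. The positivity condition on `μ X. A` and `ν X. A` is `FType.WF` below. -/
inductive FType : Type
  | var : ℕ → FType
  | arr : FType → FType → FType
  | all : FType → FType
  | one : FType
  | zero : FType
  | prod : FType → FType → FType
  | sum : FType → FType → FType
  | mu : FType → FType
  | nu : FType → FType

namespace FType

/-- `A.occ true i` (resp. `A.occ false i`) says that the variable `i` has a free positive (resp.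
negative) occurrence in `A`. -/
def occ : FType → Bool → ℕ → Bool
  | var j, b, i => b && decide (i = j)
  | arr A B, b, i => A.occ (!b) i || B.occ b i
  | all A, b, i => A.occ b (i + 1)
  | one, _, _ => false
  | zero, _, _ => false
  | prod A B, b, i => A.occ b i || B.occ b i
  | sum A B, b, i => A.occ b i || B.occ b i
  | mu A, b, i => A.occ b (i + 1)
  | nu A, b, i => A.occ b (i + 1)

/-- All free occurrences of the variable `i` in `A` are positive. -/
def OnlyPos (i : ℕ) (A : FType) : Prop := A.occ false i = false

/-- All free occurrences of the variable `i` in `A` are negative. -/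
def OnlyNeg (i : ℕ) (A : FType) : Prop := A.occ true i = false

/-- The variable `i` occurs free in `A`. -/
def free (i : ℕ) (A : FType) : Bool := A.occ true i || A.occ false i

/-- The types of the calculus: fixpoints are formed only over positive variables. -/
def WF : FType → Prop
  | var _ => True
  | arr A B => A.WF ∧ B.WF
  | all A => A.WF
  | one => True
  | zero => True
  | prod A B => A.WF ∧ B.WF
  | sum A B => A.WF ∧ B.WF
  | mu A => A.WF ∧ OnlyPos 0 A
  | nu A => A.WF ∧ OnlyPos 0 A

/-- Extension of a renaming under a binder. -/
def upRen (f : ℕ → ℕ) : ℕ → ℕ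
  | 0 => 0
  | i + 1 => f i + 1

def rename : (ℕ → ℕ) → FType → FType
  | f, var i => var (f i)
  | f, arr A B => arr (A.rename f) (B.rename f)
  | f, all A => all (A.rename (upRen f))
  | _, one => one
  | _, zero => zero
  | f, prod A B => prod (A.rename f) (B.rename f)
  | f, sum A B => sum (A.rename f) (B.rename f)
  | f, mu A => mu (A.rename (upRen f))
  | f, nu A => nu (A.rename (upRen f))

/-- `A` read under one additional binder, whose variable does not occur in it. -/
def shift (A : FType) : FType := A.rename Nat.succ

/-- Extension of a substitution under a binder. -/
def upSubst (σ : ℕ → FType) : ℕ → FType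
  | 0 => var 0
  | i + 1 => (σ i).shift

/-- Simultaneous capture-avoiding substitution. -/
def subst : (ℕ → FType) → FType → FType
  | σ, var i => σ i
  | σ, arr A B => arr (A.subst σ) (B.subst σ)
  | σ, all A => all (A.subst (upSubst σ))
  | _, one => one
  | _, zero => zero
  | σ, prod A B => prod (A.subst σ) (B.subst σ)
  | σ, sum A B => sum (A.subst σ) (B.subst σ)
  | σ, mu A => mu (A.subst (upSubst σ))
  | σ, nu A => nu (A.subst (upSubst σ))

/-- `A.inst i C` is `A[C/X]` where `X` is the variable of index `i`, which is removed from the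
context: the variables above `i` move down by one. -/
def inst (A : FType) (i : ℕ) (C : FType) : FType :=
  A.subst fun j => if j < i then var j else if j = i then C else var (j - 1)

/-- The renaming that exchanges the two innermost variables. -/
def swap01 : ℕ → ℕ
  | 0 => 1
  | 1 => 0
  | i + 2 => i + 2

/-- `∀ Y₁ … ∀ Yₘ. A`. -/
def alls : ℕ → FType → FType
  | 0, A => A
  | m + 1, A => all (alls m A)

/-- `A₁ ⇒ … ⇒ Aₖ ⇒ B`. -/
def arrs : List FType → FType → FType
  | [], B => B
  | A :: L, B => arr A (arrs L B)

/-- Finite products; the empty product is `1`. -/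
def prods : List FType → FType
  | [] => one
  | [A] => A
  | A :: B :: L => prod A (prods (B :: L))

/-- Finite sums; the empty sum is `0`. -/
def sums : List FType → FType
  | [] => zero
  | [A] => A
  | A :: B :: L => sum A (sums (B :: L))

/-- `∃ Y₁ … Yₘ. A`, that is `∀ Y'. (∀ Y₁ … ∀ Yₘ. A ⇒ Y') ⇒ Y'`; for the empty list of variables
it is `A`. -/
def exs : ℕ → FType → FType
  | 0, A => A
  | m + 1, A =>
    all (arr
      (alls (m + 1)
        (arr (A.rename fun i => if i < m + 1 then i else i + 1) (var (m + 1))))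
      (var 0))

/-- The renaming that makes the variable of index `y` the innermost one and keeps the order of the
others. -/
def toFront (y : ℕ) (i : ℕ) : ℕ := if i < y then i + 1 else if i = y then 0 else i

/-- `{μ X.} T`, where `X` is the variable of index `y` in `T`: the binder is applied only if `X`
occurs in `T`. In both cases `X` is removed from the context. -/
def muOpt (y : ℕ) (T : FType) : FType :=
  if T.free y then mu (T.rename (toFront y)) else T.inst y one

/-- `{ν X.} T`, where `X` is the variable of index `y` in `T`: the binder is applied only if `X`
occurs in `T`. In both cases `X` is removed from the context. -/
def nuOpt (y : ℕ) (T : FType) : FType :=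
  if T.free y then nu (T.rename (toFront y)) else T.inst y one

end FType

open FType in
/-- The axiomatization of `βη`-isomorphisms. -/
inductive BetaEtaAx : FType → FType → Prop
  | arr_swap (A B C : FType) : BetaEtaAx (arr A (arr B C)) (arr B (arr A C))
  | all_swap (A : FType) : BetaEtaAx (all (all A)) (all (all (A.rename swap01)))
  | all_vacuous (A : FType) : BetaEtaAx A (all A.shift)
  | arr_all (A B : FType) : BetaEtaAx (arr A (all B)) (all (arr A.shift B))
  | prod_one (A : FType) : BetaEtaAx (prod A one) A
  | one_arr (A : FType) : BetaEtaAx (arr one A) A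
  | prod_assoc (A B C : FType) : BetaEtaAx (prod A (prod B C)) (prod (prod A B) C)
  | prod_comm (A B : FType) : BetaEtaAx (prod A B) (prod B A)
  | curry (A B C : FType) : BetaEtaAx (arr (prod A B) C) (arr A (arr B C))
  | all_prod (A B : FType) : BetaEtaAx (all (prod A B)) (prod (all A) (all B))
  | sum_zero (A : FType) : BetaEtaAx (sum A zero) A
  | prod_zero (A : FType) : BetaEtaAx (prod A zero) zero
  | zero_arr (A : FType) : BetaEtaAx (arr zero A) one
  | sum_assoc (A B C : FType) : BetaEtaAx (sum A (sum B C)) (sum (sum A B) C)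
  | sum_comm (A B : FType) : BetaEtaAx (sum A B) (sum B A)
  | prod_sum (A B C : FType) : BetaEtaAx (prod A (sum B C)) (sum (prod A B) (prod A C))
  | sum_arr (A B C : FType) : BetaEtaAx (arr (sum A B) C) (prod (arr A C) (arr B C))
  | mu_vacuous (A : FType) : BetaEtaAx (mu A.shift) A
  | nu_vacuous (A : FType) : BetaEtaAx (nu A.shift) A
  | mu_unfold (A : FType) : BetaEtaAx (mu A) (A.inst 0 (mu A))
  | nu_unfold (A : FType) : BetaEtaAx (nu A) (A.inst 0 (nu A))

open FType in
/-- The two schemas of Yoneda type isomorphisms. Inside `∀ X. ∀ Y₁ … ∀ Y_y` the variable `X` has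
index `y`. The list `H` has one entry for each `k`, whose first component is the number of variables
in the list `Z_k`; inside `∀ Z_k` the variable `X` has index `y + h.1`. -/
inductive YonedaAx : FType → FType → Prop
  /-- `∀X.∀Y. ⟨∀Z_k. ⟨A_jk⟩_j ⇒ X⟩_k ⇒ B  ≡  ∀Y. B[X ↦ {μX.} ∑_k ∃Z_k. ∏_j A_jk]`, where `X` is
  only positive in the `A_jk` and in `B`. -/
  | pos (y : ℕ) (H : List (ℕ × List FType)) (B : FType)
      (hA : ∀ h ∈ H, ∀ A ∈ h.2, OnlyPos (y + h.1) A) (hB : OnlyPos y B) :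
      YonedaAx
        (all (alls y
          (arrs (H.map fun h => alls h.1 (arrs h.2 (var (y + h.1)))) B)))
        (alls y (B.inst y (muOpt y (sums (H.map fun h => exs h.1 (prods h.2))))))
  /-- `∀X.∀Y. ⟨∀Z_k. X ⇒ A_k⟩_k ⇒ B  ≡  ∀Y. B[X ↦ {νX.} ∏_k ∀Z_k. A_k]`, where `X` is only
  positive in the `A_k` (so negative in the whole type) and only negative in `B`. -/
  | neg (y : ℕ) (H : List (ℕ × FType)) (B : FType)
      (hA : ∀ h ∈ H, OnlyPos (y + h.1) h.2) (hB : OnlyNeg y B) :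
      YonedaAx
        (all (alls y
          (arrs (H.map fun h => alls h.1 (arr (var (y + h.1)) h.2)) B)))
        (alls y (B.inst y (nuOpt y (prods (H.map fun h => alls h.1 h.2)))))

open FType in
/-- `A ≡_Y B`: the type `A` can be converted to the type `B` by the Yoneda type isomorphisms and the
axiomatized `βη`-isomorphisms, applied in either direction and in any context. All types involved
are well formed. -/
inductive YonedaEquiv : FType → FType → Prop
  | beta_eta {A B : FType} : BetaEtaAx A B → A.WF → B.WF → YonedaEquiv A B
  | yoneda {A B : FType} : YonedaAx A B → A.WF → B.WF → YonedaEquiv A B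
  | refl {A : FType} : A.WF → YonedaEquiv A A
  | symm {A B : FType} : YonedaEquiv A B → YonedaEquiv B A
  | trans {A B C : FType} : YonedaEquiv A B → YonedaEquiv B C → YonedaEquiv A C
  | arr {A A' B B' : FType} :
      YonedaEquiv A A' → YonedaEquiv B B' → YonedaEquiv (arr A B) (arr A' B')
  | all {A A' : FType} : YonedaEquiv A A' → YonedaEquiv (all A) (all A')
  | prod {A A' B B' : FType} :
      YonedaEquiv A A' → YonedaEquiv B B' → YonedaEquiv (prod A B) (prod A' B')
  | sum {A A' B B' : FType} :
      YonedaEquiv A A' → YonedaEquiv B B' → YonedaEquiv (sum A B) (sum A' B')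
  | mu {A A' : FType} : YonedaEquiv A A' → OnlyPos 0 A → OnlyPos 0 A' →
      YonedaEquiv (mu A) (mu A')
  | nu {A A' : FType} : YonedaEquiv A A' → OnlyPos 0 A → OnlyPos 0 A' →
      YonedaEquiv (nu A) (nu A')

/-! ### Simple types and the simply typed lambda-calculus -/

/-- Simple types over a countable set of type variables. -/
inductive SType : Type
  | var : ℕ → SType
  | arr : SType → SType → SType

/-- Terms of the simply typed lambda-calculus à la Church, with de Bruijn indices. -/
inductive STerm : Type
  | var : ℕ → STerm
  | lam : SType → STerm → STerm
  | app : STerm → STerm → STerm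

/-- The typing judgement `Γ ⊢ t : A`. -/
inductive STerm.HasType : List SType → STerm → SType → Prop
  | var {Γ : List SType} {x : ℕ} {A : SType} : Γ[x]? = some A → HasType Γ (STerm.var x) A
  | lam {Γ : List SType} {A B : SType} {t : STerm} :
      HasType (A :: Γ) t B → HasType Γ (STerm.lam A t) (SType.arr A B)
  | app {Γ : List SType} {A B : SType} {t u : STerm} :
      HasType Γ t (SType.arr A B) → HasType Γ u A → HasType Γ (STerm.app t u) B

namespace SType

/-- Some closed term has type `A`. -/
def IsInhabited (A : SType) : Prop := ∃ t : STerm, STerm.HasType [] t A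

/-- The number of positive (`b = true`) or negative (`b = false`) occurrences of a variable. -/
def count : SType → Bool → ℕ → ℕ
  | var j, b, i => if b = true ∧ i = j then 1 else 0
  | arr A B, b, i => A.count (!b) i + B.count b i

/-- The variable `i` occurs in `A`. -/
def Occurs (i : ℕ) : SType → Prop
  | var j => i = j
  | arr A B => Occurs i A ∨ Occurs i B

/-- Every variable of `A` occurs exactly once positively and exactly once negatively. -/
def Balanced (A : SType) : Prop :=
  ∀ i, Occurs i A → A.count true i = 1 ∧ A.count false i = 1

/-- No variable has two negative occurrences in `A`. -/
def NegNonDup (A : SType) : Prop := ∀ i, A.count false i ≤ 1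

/-- Simple types as types of the larger calculus. -/
def toFType : SType → FType
  | var i => FType.var i
  | arr A B => FType.arr A.toFType B.toFType

end SType

/-! Let `F` range over the hereditary premises of `A` that stand negatively. Introduce a fresh
variable `c_F` for each of them and a premise `c_F ⇒ F'`, where `F'` is `F` with the negative
premises inside it replaced by their own fresh variables: the Yoneda isomorphisms for greatest
fixpoints eliminate the `c_F` and give back `A`. As no variable has two negative occurrences, the
head `z` of `F` determines `F`, and `c_F ⇒ F'` is after uncurrying the only premise ending in `z`.
So the isomorphisms for least fixpoints eliminate the variables of `A` instead, and turn each goal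
`z` into the product of `c_F` and the premises of `F'`.

The type that is left follows the unique long normal proof of `A`: implication distributes over the
product, each premise of `F'` is a goal of the proof, and at each `c_F` there remains a type `… ⇒
c_F ⇒ … ⇒ c_F`. No branch of the proof repeats a goal, so `c_F` is only once among the premises of
this type, and the Yoneda isomorphism that substitutes `1` for `c_F` shows that the type is `1`. -/

namespace FType

/-! ### Renaming and substitution -/

theorem subst_congr (A : FType) {σ τ : ℕ → FType}
    (h : ∀ j b, A.occ b j = true → σ j = τ j) : A.subst σ = A.subst τ := by
  have binder {A : FType} {σ τ : ℕ → FType} (h : ∀ j b, A.occ b (j + 1) = true → σ j = τ j)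
      (j : ℕ) (b : Bool) (hj : A.occ b j = true) : upSubst σ j = upSubst τ j := by
    cases j with
    | zero => rfl
    | succ j => exact congrArg shift (h j b hj)
  induction A generalizing σ τ with
  | var j => exact h j true (by simp [occ])
  | arr A B ihA ihB =>
    simp only [occ, Bool.or_eq_true] at h
    exact congrArg₂ arr (ihA fun j b hj => h j (!b) (.inl (by simpa using hj)))
      (ihB fun j b hj => h j b (.inr hj))
  | prod A B ihA ihB =>
    simp only [occ, Bool.or_eq_true] at h
    exact congrArg₂ prod (ihA fun j b hj => h j b (.inl hj)) (ihB fun j b hj => h j b (.inr hj))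
  | sum A B ihA ihB =>
    simp only [occ, Bool.or_eq_true] at h
    exact congrArg₂ sum (ihA fun j b hj => h j b (.inl hj)) (ihB fun j b hj => h j b (.inr hj))
  | all A ih => exact congrArg all (ih (binder h))
  | mu A ih => exact congrArg mu (ih (binder h))
  | nu A ih => exact congrArg nu (ih (binder h))
  | one => rfl
  | zero => rfl

theorem upSubst_var : upSubst var = var := by
  funext j
  cases j <;> rfl

theorem subst_var (A : FType) : A.subst var = A := by
  induction A <;> simp_all [subst, upSubst_var]

theorem rename_eq_subst (A : FType) (f : ℕ → ℕ) : A.rename f = A.subst fun j => var (f j) := by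
  have binder (f : ℕ → ℕ) : (upSubst fun j => var (f j)) = fun j => var (upRen f j) := by
    funext j
    cases j <;> rfl
  induction A generalizing f <;> simp_all [rename, subst]

theorem subst_rename (A : FType) (f : ℕ → ℕ) (σ : ℕ → FType) :
    (A.rename f).subst σ = A.subst fun j => σ (f j) := by
  have binder (f : ℕ → ℕ) (σ : ℕ → FType) :
      (fun j => upSubst σ (upRen f j)) = upSubst fun j => σ (f j) := by
    funext j
    cases j <;> rfl
  induction A generalizing f σ <;> simp_all [rename, subst]

theorem rename_rename (A : FType) (f g : ℕ → ℕ) :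
    (A.rename f).rename g = A.rename fun j => g (f j) := by
  rw [rename_eq_subst, subst_rename, ← rename_eq_subst]

theorem rename_subst (A : FType) (σ : ℕ → FType) (f : ℕ → ℕ) :
    (A.subst σ).rename f = A.subst fun j => (σ j).rename f := by
  have binder (σ : ℕ → FType) (f : ℕ → ℕ) :
      (upSubst fun j => (σ j).rename f) = fun j => (upSubst σ j).rename (upRen f) := by
    funext j
    cases j with
    | zero => rfl
    | succ j => simp only [upSubst, shift, rename_rename, upRen]
  induction A generalizing σ f <;> simp_all [rename, subst]

theorem subst_subst (A : FType) (σ τ : ℕ → FType) :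
    (A.subst σ).subst τ = A.subst fun j => (σ j).subst τ := by
  have binder (σ τ : ℕ → FType) :
      (upSubst fun j => (σ j).subst τ) = fun j => (upSubst σ j).subst (upSubst τ) := by
    funext j
    cases j with
    | zero => rfl
    | succ j => simp only [upSubst, shift, rename_subst, subst_rename]
  induction A generalizing σ τ <;> simp_all [subst]

theorem rename_eq_self {A : FType} {f : ℕ → ℕ} (h : ∀ i b, A.occ b i = true → f i = i) :
    A.rename f = A := by
  rw [rename_eq_subst, subst_congr A fun j b hj => congrArg var (h j b hj)]
  exact subst_var A

theorem inst_zero_shift (A T : FType) : A.shift.inst 0 T = A := by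
  rw [inst, shift, subst_rename]
  exact subst_var A

/-! ### Occurrences and well-formedness -/

theorem occ_rename {A : FType} {f : ℕ → ℕ} {b : Bool} {i : ℕ} :
    (A.rename f).occ b i = true ↔ ∃ j, A.occ b j = true ∧ f j = i := by
  have binder (A : FType) (f : ℕ → ℕ) (b : Bool) (i : ℕ) :
      (∃ j, A.occ b j = true ∧ upRen f j = i + 1) ↔ ∃ j, A.occ b (j + 1) = true ∧ f j = i := by
    constructor
    · rintro ⟨_ | j, h, e⟩
      · simp [upRen] at e
      · exact ⟨j, h, by simpa [upRen] using e⟩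
    · rintro ⟨j, h, e⟩
      exact ⟨j + 1, h, by simp [upRen, e]⟩
  induction A generalizing f b i with
  | var j => simp [rename, occ]; grind
  | arr A B ihA ihB => simp [rename, occ, ihA, ihB, or_and_right, exists_or]
  | prod A B ihA ihB => simp [rename, occ, ihA, ihB, or_and_right, exists_or]
  | sum A B ihA ihB => simp [rename, occ, ihA, ihB, or_and_right, exists_or]
  | all A ih => simp only [rename, occ, ih, binder]
  | mu A ih => simp only [rename, occ, ih, binder]
  | nu A ih => simp only [rename, occ, ih, binder]
  | one => simp [rename, occ]
  | zero => simp [rename, occ]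

theorem occ_shift_zero (A : FType) (b : Bool) : A.shift.occ b 0 = false := by
  rw [← Bool.not_eq_true, shift, occ_rename]
  rintro ⟨j, -, h⟩
  exact Nat.succ_ne_zero j h

theorem occ_shift_succ (A : FType) (b : Bool) (i : ℕ) : A.shift.occ b (i + 1) = A.occ b i := by
  rw [Bool.eq_iff_iff, shift, occ_rename]
  simp

theorem occ_subst {A : FType} {σ : ℕ → FType} {b : Bool} {i : ℕ} :
    (A.subst σ).occ b i = true ↔ ∃ j c, A.occ c j = true ∧ (σ j).occ (b == c) i = true := by
  have binder (A : FType) (σ : ℕ → FType) (b : Bool) (i : ℕ) :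
      (∃ j c, A.occ c j = true ∧ (upSubst σ j).occ (b == c) (i + 1) = true) ↔
        ∃ j c, A.occ c (j + 1) = true ∧ (σ j).occ (b == c) i = true := by
    constructor
    · rintro ⟨_ | j, c, h, e⟩
      · simp [upSubst, occ] at e
      · exact ⟨j, c, h, by simpa [upSubst, occ_shift_succ] using e⟩
    · rintro ⟨j, c, h, e⟩
      exact ⟨j + 1, c, h, by simpa [upSubst, occ_shift_succ] using e⟩
  induction A generalizing σ b i with
  | var j => cases b <;> simp [subst, occ]
  | arr A B ihA ihB =>
    simp only [subst, occ, Bool.or_eq_true, ihA, ihB]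
    constructor
    · rintro (⟨j, c, h, e⟩ | ⟨j, c, h, e⟩)
      · exact ⟨j, !c, .inl (by simpa using h), by cases b <;> cases c <;> exact e⟩
      · exact ⟨j, c, .inr h, e⟩
    · rintro ⟨j, c, h | h, e⟩
      · exact .inl ⟨j, !c, h, by cases b <;> cases c <;> exact e⟩
      · exact .inr ⟨j, c, h, e⟩
  | prod A B ihA ihB => simp [subst, occ, ihA, ihB, or_and_right, exists_or]
  | sum A B ihA ihB => simp [subst, occ, ihA, ihB, or_and_right, exists_or]
  | all A ih => simp only [subst, occ, ih, binder]
  | mu A ih => simp only [subst, occ, ih, binder]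
  | nu A ih => simp only [subst, occ, ih, binder]
  | one => simp [subst, occ]
  | zero => simp [subst, occ]

theorem OnlyPos.not_occ {i : ℕ} {A : FType} (h : OnlyPos i A) : ¬ A.occ false i = true :=
  Bool.not_eq_true _ ▸ h

theorem occ_subst_eq_false {A : FType} {σ : ℕ → FType} {b : Bool} {i : ℕ}
    (hA : A.occ b i = false) (hfix : ∀ j, A.occ b j = true → σ j = var j)
    (hpos : ∀ j, OnlyPos i (σ j)) : (A.subst σ).occ b i = false := by
  rw [← Bool.not_eq_true, occ_subst]
  rintro ⟨j, c, hj, h⟩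
  by_cases hc : b = c
  · subst hc
    rw [hfix j hj] at h
    have hij : i = j := by simpa [occ] using h
    simp [← hij, hA] at hj
  · rw [beq_eq_false_iff_ne.2 hc] at h
    exact (hpos j).not_occ h

theorem WF.rename {A : FType} (h : A.WF) (f : ℕ → ℕ) : (A.rename f).WF := by
  have binder {A : FType} {f : ℕ → ℕ} (h : OnlyPos 0 A) : OnlyPos 0 (A.rename (upRen f)) := by
    rw [OnlyPos, ← Bool.not_eq_true, occ_rename]
    rintro ⟨_ | j, hj, e⟩
    · simp [OnlyPos, hj] at h
    · simp [upRen] at e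
  induction A generalizing f with
  | mu A ih => exact ⟨ih h.1 _, binder h.2⟩
  | nu A ih => exact ⟨ih h.1 _, binder h.2⟩
  | _ => simp_all [FType.rename, WF]

theorem WF.subst {A : FType} (h : A.WF) {σ : ℕ → FType} (hσ : ∀ j, (σ j).WF) :
    (A.subst σ).WF := by
  have binder {A : FType} {σ : ℕ → FType} (h : OnlyPos 0 A) :
      OnlyPos 0 (A.subst (upSubst σ)) := by
    rw [OnlyPos, ← Bool.not_eq_true, occ_subst]
    rintro ⟨_ | j, _ | _, hj, e⟩
    · simp [OnlyPos, hj] at h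
    · simp [upSubst, occ] at e
    all_goals simp [upSubst, occ_shift_zero] at e
  have up {σ : ℕ → FType} (hσ : ∀ j, (σ j).WF) : ∀ j, (upSubst σ j).WF
    | 0 => trivial
    | j + 1 => (hσ j).rename _
  induction A generalizing σ with
  | var j => exact hσ j
  | arr A B ihA ihB => exact ⟨ihA h.1 hσ, ihB h.2 hσ⟩
  | prod A B ihA ihB => exact ⟨ihA h.1 hσ, ihB h.2 hσ⟩
  | sum A B ihA ihB => exact ⟨ihA h.1 hσ, ihB h.2 hσ⟩
  | all A ih => exact ih h (up hσ)
  | mu A ih => exact ⟨ih h.1 (up hσ), binder h.2⟩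
  | nu A ih => exact ⟨ih h.1 (up hσ), binder h.2⟩
  | one => trivial
  | zero => trivial

theorem WF.inst {A T : FType} (hA : A.WF) (hT : T.WF) (i : ℕ) : (A.inst i T).WF :=
  hA.subst fun j => by split_ifs <;> trivial

theorem free_eq_false {A : FType} {i : ℕ} : A.free i = false ↔ ∀ b, A.occ b i = false := by
  simp [free, and_comm]

/-! ### Substitution for one variable -/

/-- `A[T/X]` where `X` has index `i`. Unlike in `FType.inst`, the variable `X` stays in the
context, so the other variables keep their indices. -/
def repl (i : ℕ) (T A : FType) : FType := A.subst (Function.update var i T)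

theorem repl_eq_self {A : FType} {i : ℕ} (h : A.free i = false) (T : FType) :
    repl i T A = A := by
  conv_rhs => rw [← subst_var A]
  refine subst_congr A fun j b hj => Function.update_of_ne ?_ _ _
  rintro rfl
  simp [free_eq_false.1 h] at hj

theorem WF.repl {A T : FType} (hA : A.WF) (hT : T.WF) (i : ℕ) : (repl i T A).WF :=
  hA.subst fun j => by
    rw [Function.update_apply]
    split_ifs <;> trivial

/-- The renaming that makes room for a variable of index `i`. -/
def skip (i j : ℕ) : ℕ := if j < i then j else j + 1

theorem upRen_skip (i : ℕ) : upRen (skip i) = skip (i + 1) := by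
  funext j
  cases j with
  | zero => simp [upRen, skip]
  | succ j => simp only [upRen, skip]; split_ifs <;> omega

theorem rename_skip_inst (A : FType) (i : ℕ) (T : FType) :
    (A.inst i T).rename (skip i) = repl i (T.rename (skip i)) A := by
  rw [inst, rename_subst, repl]
  congr 1
  funext j
  rcases lt_trichotomy j i with h | h | h
  · simp [h, rename, skip, Function.update_of_ne h.ne]
  · simp [h]
  · simp [h.not_gt, h.ne', rename, skip]
    split_ifs <;> omega

/-! ### Iterated constructors -/

theorem alls_add (m n : ℕ) (A : FType) : alls (m + n) A = alls m (alls n A) := by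
  induction m with
  | zero => simp [alls]
  | succ m ih => rw [Nat.succ_add, alls, alls, ih]

theorem shift_alls (n : ℕ) (A : FType) : (alls n A).shift = alls n (A.rename (skip n)) := by
  have rename_alls (i : ℕ) : (alls n A).rename (skip i) = alls n (A.rename (skip (i + n))) := by
    induction n generalizing i with
    | zero => rfl
    | succ n ih => rw [alls, rename, upRen_skip, ih, alls, Nat.add_right_comm, Nat.add_assoc]
  simpa [shift, funext fun j => (show skip 0 j = j.succ by simp [skip])] using rename_alls 0

theorem wf_alls {n : ℕ} {A : FType} : (alls n A).WF ↔ A.WF := by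
  induction n with
  | zero => rfl
  | succ _ ih => exact ih

theorem wf_arrs {L : List FType} {B : FType} : (arrs L B).WF ↔ (∀ A ∈ L, A.WF) ∧ B.WF := by
  induction L with
  | nil => simp [arrs]
  | cons A L ih => simp [arrs, WF, ih, and_assoc]

theorem wf_prods {L : List FType} : (prods L).WF ↔ ∀ A ∈ L, A.WF := by
  induction L using prods.induct <;> simp_all [prods, WF]

theorem occ_prods {L : List FType} {b : Bool} {i : ℕ} :
    (prods L).occ b i = true ↔ ∃ A ∈ L, A.occ b i = true := by
  induction L using prods.induct <;> simp_all [prods, occ]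

theorem occ_arrs {L : List FType} {B : FType} {b : Bool} {i : ℕ} :
    (arrs L B).occ b i = true ↔ (∃ A ∈ L, A.occ (!b) i = true) ∨ B.occ b i = true := by
  induction L with
  | nil => simp [arrs]
  | cons A L ih => simp [arrs, occ, ih, or_assoc]

theorem arrs_append (L M : List FType) (B : FType) : arrs (L ++ M) B = arrs L (arrs M B) := by
  induction L with
  | nil => rfl
  | cons A L ih => exact congrArg (arr A) ih

theorem subst_arrs (L : List FType) (B : FType) (σ : ℕ → FType) :
    (arrs L B).subst σ = arrs (L.map fun A => A.subst σ) (B.subst σ) := by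
  induction L with
  | nil => rfl
  | cons A L ih => exact congrArg (arr (A.subst σ)) ih

theorem subst_prods (L : List FType) (σ : ℕ → FType) :
    (prods L).subst σ = prods (L.map fun A => A.subst σ) := by
  induction L using prods.induct <;> simp_all [prods, subst]

/-! ### Fixpoints -/

/-- The binder `μ` (for `s = true`) or `ν` (for `s = false`), so that the two schemas of Yoneda
isomorphisms can be treated together. -/
def fix : Bool → FType → FType
  | true => mu
  | false => nu

/-- `{μX.} P` or `{νX.} P`, where `X` has index `i`. The variable `X` stays in the context, so the
other variables keep their indices. -/
def fixAt (s : Bool) (i : ℕ) (P : FType) : FType :=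
  if P.free i then fix s (P.rename fun j => if j = i then 0 else j + 1) else P

theorem rename_skip_fixOpt (s : Bool) (i : ℕ) (P : FType) :
    (bif s then muOpt i P else nuOpt i P).rename (skip i) = fixAt s i P := by
  have upRen_skip_toFront (j : ℕ) :
      upRen (skip i) (toFront i j) = if j = i then 0 else j + 1 := by
    rcases lt_trichotomy j i with h | h | h
    · simp [toFront, upRen, skip, h, h.ne]
    · simp [toFront, upRen, h]
    · obtain ⟨k, rfl⟩ := Nat.exists_eq_add_of_lt h
      have h₁ : ¬ i + k + 1 < i := by omega
      have h₂ : ¬ i + k < i := by omega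
      have h₃ : i + k + 1 ≠ i := by omega
      simp only [toFront, h₁, h₃, if_false, upRen, skip, h₂]
  by_cases h : P.free i = true
  · cases s <;>
      simp [muOpt, nuOpt, fixAt, fix, h, rename, rename_rename, upRen_skip_toFront]
  · cases s <;>
      simp [muOpt, nuOpt, fixAt, h, rename_skip_inst, repl_eq_self]

theorem occ_of_occ_fixAt {s : Bool} {i : ℕ} {P : FType} {b : Bool} {j : ℕ}
    (h : (fixAt s i P).occ b j = true) : P.occ b j = true := by
  rw [fixAt] at h
  split_ifs at h
  · have h' : (P.rename fun j => if j = i then 0 else j + 1).occ b (j + 1) = true := by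
      cases s <;> exact h
    obtain ⟨k, hk, e⟩ := occ_rename.1 h'
    split_ifs at e
    exact Nat.succ_injective e ▸ hk
  · exact h

theorem WF.fixOpt {P : FType} (hP : P.WF) {i : ℕ} (hi : OnlyPos i P) (s : Bool) :
    (bif s then muOpt i P else nuOpt i P).WF := by
  have hpos : OnlyPos 0 (P.rename (toFront i)) := by
    rw [OnlyPos, ← Bool.not_eq_true, occ_rename]
    rintro ⟨j, hj, e⟩
    have hji : j = i := by
      simp only [toFront] at e
      split_ifs at e <;> omega
    exact hi.not_occ (hji ▸ hj)
  cases s <;> simp only [cond_true, cond_false, muOpt, nuOpt] <;> split_ifs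
  · exact ⟨hP.rename _, hpos⟩
  · exact hP.inst (T := one) trivial i
  · exact ⟨hP.rename _, hpos⟩
  · exact hP.inst (T := one) trivial i

theorem WF.fixAt {P : FType} (hP : P.WF) {i : ℕ} (hi : OnlyPos i P) (s : Bool) :
    (fixAt s i P).WF :=
  rename_skip_fixOpt s i P ▸ (hP.fixOpt hi s).rename _

/-- `A` unfolds to `B`: either `A` is `B`, or `B` is obtained from `A` by unfolding a fixpoint at
the root once. -/
inductive Unfolds : FType → FType → Prop
  | refl (A : FType) : Unfolds A A
  | fix (s : Bool) (Q : FType) : Unfolds (fix s Q) (Q.inst 0 (fix s Q))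

theorem Unfolds.subst {A B : FType} (h : Unfolds A B) (σ : ℕ → FType) :
    Unfolds (A.subst σ) (B.subst σ) := by
  cases h with
  | refl => exact .refl _
  | fix s Q =>
    have subst_fix : (FType.fix s Q).subst σ = FType.fix s (Q.subst (upSubst σ)) := by
      cases s <;> rfl
    have subst_inst : (Q.inst 0 (FType.fix s Q)).subst σ =
        (Q.subst (upSubst σ)).inst 0 (FType.fix s (Q.subst (upSubst σ))) := by
      simp only [inst, subst_subst]
      congr 1
      funext j
      cases j with
      | zero => exact subst_fix
      | succ j => exact (inst_zero_shift (σ j) _).symm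
    rw [subst_fix, subst_inst]
    exact .fix _ _

theorem unfolds_fixAt (s : Bool) (i : ℕ) (P : FType) :
    Unfolds (fixAt s i P) (repl i (fixAt s i P) P) := by
  by_cases h : P.free i = true
  · have e : repl i (fixAt s i P) P =
        (P.rename fun j => if j = i then 0 else j + 1).inst 0 (fixAt s i P) := by
      rw [repl, inst, subst_rename]
      congr 1
      funext j
      by_cases hj : j = i <;> simp [hj]
    rw [e, fixAt, if_pos h]
    exact .fix _ _
  · rw [repl_eq_self (by simpa using h), fixAt, if_neg h]
    exact .refl _

/-! ### Systems of recursive definitions -/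

/-- A system of recursive definitions `X := P`, given by the pairs of the index of `X` and of the
type `P`, in which all defined variables occur only positively. -/
structure IsSystem (Z : List (ℕ × FType)) : Prop where
  nodup : (Z.map Prod.fst).Nodup
  wf : ∀ p ∈ Z, p.2.WF
  onlyPos : ∀ p ∈ Z, ∀ q ∈ Z, OnlyPos q.1 p.2

theorem IsSystem.tail {p : ℕ × FType} {Z : List (ℕ × FType)} (h : IsSystem (p :: Z)) :
    IsSystem Z where
  nodup := (List.nodup_cons.1 h.nodup).2
  wf q hq := h.wf q (.tail p hq)
  onlyPos q hq r hr := h.onlyPos q (.tail p hq) r (.tail p hr)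

/-- The least (`s = true`) or greatest (`s = false`) solution of a system of recursive definitions,
by Bekić's elimination of one variable at a time. -/
def solve (s : Bool) : List (ℕ × FType) → ℕ → FType
  | [] => var
  | (k, P) :: Z => fun j => repl k (fixAt s k (P.subst (solve s Z))) (solve s Z j)

theorem subst_solve_cons (s : Bool) (k : ℕ) (P : FType) (Z : List (ℕ × FType)) (A : FType) :
    A.subst (solve s ((k, P) :: Z)) =
      repl k (fixAt s k (P.subst (solve s Z))) (A.subst (solve s Z)) :=
  (subst_subst A _ _).symm

theorem solve_of_notMem {s : Bool} {Z : List (ℕ × FType)} {j : ℕ} (h : j ∉ Z.map Prod.fst) :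
    solve s Z j = var j := by
  induction Z with
  | nil => rfl
  | cons p Z ih =>
    rw [List.map_cons, List.mem_cons, not_or] at h
    simp only [solve, ih h.2]
    exact Function.update_of_ne h.1 _ _

theorem solve_of_occ {s : Bool} {Z : List (ℕ × FType)} {A : FType} {b : Bool}
    (h : ∀ p ∈ Z, A.occ b p.1 = false) {j : ℕ} (hj : A.occ b j = true) :
    solve s Z j = var j := by
  refine solve_of_notMem fun hmem => ?_
  obtain ⟨p, hp, rfl⟩ := List.mem_map.1 hmem
  simp [h p hp] at hj

namespace IsSystem

variable {Z : List (ℕ × FType)} (s : Bool)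

theorem onlyPos_solve (hZ : IsSystem Z) {i : ℕ} (hi : ∀ p ∈ Z, OnlyPos i p.2) (j : ℕ) :
    OnlyPos i (solve s Z j) := by
  induction Z generalizing i j with
  | nil => simp [solve, OnlyPos, occ]
  | cons p Z ih =>
    obtain ⟨hp, hi⟩ := List.forall_mem_cons.1 hi
    have hsol := ih hZ.tail hi
    have hkey := ih hZ.tail (i := p.1) fun q hq => hZ.onlyPos q (.tail p hq) p (.head Z)
    have hfix : OnlyPos i (fixAt s p.1 (p.2.subst (solve s Z))) := by
      rw [OnlyPos, ← Bool.not_eq_true]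
      refine fun h => Bool.not_eq_true _ ▸ (occ_subst_eq_false hp (fun j => ?_) hsol) <|
        occ_of_occ_fixAt h
      exact solve_of_occ fun q hq => hZ.onlyPos p (.head Z) q (.tail p hq)
    refine occ_subst_eq_false (hsol j) (fun l hl => Function.update_of_ne ?_ _ _) fun l => ?_
    · rintro rfl
      exact (hkey j).not_occ hl
    · rw [Function.update_apply]
      split_ifs
      · exact hfix
      · simp [OnlyPos, occ]

theorem onlyPos_subst_solve (hZ : IsSystem Z) {A : FType} {b : Bool}
    (hA : ∀ p ∈ Z, A.occ b p.1 = false) {i : ℕ} (hi : ∀ p ∈ Z, OnlyPos i p.2)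
    (hAi : A.occ b i = false) : (A.subst (solve s Z)).occ b i = false :=
  occ_subst_eq_false hAi (fun _ => solve_of_occ hA) (hZ.onlyPos_solve s hi)

theorem wf_solve (hZ : IsSystem Z) (j : ℕ) : (solve s Z j).WF := by
  induction Z generalizing j with
  | nil => trivial
  | cons p Z ih =>
    refine (ih hZ.tail j).repl (WF.fixAt ((hZ.wf p (.head Z)).subst (ih hZ.tail)) ?_ s) p.1
    exact hZ.tail.onlyPos_subst_solve s (fun q hq => hZ.onlyPos p (.head Z) q (.tail p hq))
      (fun q hq => hZ.onlyPos q (.tail p hq) p (.head Z)) (hZ.onlyPos p (.head Z) p (.head Z))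

theorem unfolds_solve (hZ : IsSystem Z) {p : ℕ × FType} (hp : p ∈ Z) :
    Unfolds (solve s Z p.1) (p.2.subst (solve s Z)) := by
  induction Z with
  | nil => cases hp
  | cons q Z ih =>
    rw [subst_solve_cons]
    rcases List.mem_cons.1 hp with rfl | hp
    · have hkey : solve s Z p.1 = var p.1 := solve_of_notMem (List.nodup_cons.1 hZ.nodup).1
      simpa [solve, hkey, repl, subst] using unfolds_fixAt s p.1 (p.2.subst (solve s Z))
    · exact (ih hZ.tail hp).subst _

end IsSystem

end FType

local infix:50 " ≡ʸ " => YonedaEquiv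

namespace YonedaEquiv

open FType

/-! ### Derived isomorphisms -/

instance : Trans YonedaEquiv YonedaEquiv YonedaEquiv := ⟨.trans⟩

theorem wf {A B : FType} (h : A ≡ʸ B) : A.WF ∧ B.WF := by
  induction h <;> simp_all [WF]

theorem alls {A B : FType} (h : A ≡ʸ B) (n : ℕ) : alls n A ≡ʸ alls n B := by
  induction n with
  | zero => exact h
  | succ n ih => exact ih.all

theorem arrs {L L' : List FType} (hL : List.Forall₂ YonedaEquiv L L') {B B' : FType}
    (hB : B ≡ʸ B') : arrs L B ≡ʸ arrs L' B' := by
  induction hL with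
  | nil => exact hB
  | cons h _ ih => exact h.arr ih

theorem arr_comm {A B C : FType} (hA : A.WF) (hB : B.WF) (hC : C.WF) :
    FType.arr A (FType.arr B C) ≡ʸ FType.arr B (FType.arr A C) :=
  .beta_eta (.arr_swap _ _ _) ⟨hA, hB, hC⟩ ⟨hB, hA, hC⟩

theorem arr_all {A B : FType} (hA : A.WF) (hB : B.WF) :
    FType.arr A (FType.all B) ≡ʸ FType.all (FType.arr A.shift B) :=
  .beta_eta (.arr_all _ _) ⟨hA, hB⟩ ⟨hA.rename _, hB⟩

theorem sum_arr {A B C : FType} (hA : A.WF) (hB : B.WF) (hC : C.WF) :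
    FType.arr (FType.sum A B) C ≡ʸ FType.prod (FType.arr A C) (FType.arr B C) :=
  .beta_eta (.sum_arr _ _ _) ⟨⟨hA, hB⟩, hC⟩ ⟨⟨hA, hC⟩, hB, hC⟩

theorem all_prod {A B : FType} (hA : A.WF) (hB : B.WF) :
    FType.all (FType.prod A B) ≡ʸ FType.prod (FType.all A) (FType.all B) :=
  .beta_eta (.all_prod _ _) ⟨hA, hB⟩ ⟨hA, hB⟩

theorem alls_prod (n : ℕ) {A B : FType} (hA : A.WF) (hB : B.WF) :
    FType.alls n (FType.prod A B) ≡ʸ FType.prod (FType.alls n A) (FType.alls n B) := by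
  induction n with
  | zero => exact .refl ⟨hA, hB⟩
  | succ n ih => exact ih.all.trans (all_prod ih.wf.2.1 ih.wf.2.2)

theorem arrs_perm {L L' : List FType} (hp : L.Perm L') {B : FType} (h : (FType.arrs L B).WF) :
    FType.arrs L B ≡ʸ FType.arrs L' B := by
  induction hp with
  | nil => exact .refl h
  | cons A _ ih => exact .arr (.refl h.1) (ih h.2)
  | swap A A' L => exact arr_comm h.1 h.2.1 h.2.2
  | trans _ _ ih₁ ih₂ => exact (ih₁ h).trans (ih₂ (ih₁ h).wf.2)

theorem arr_arrs_comm {A B : FType} {L : List FType} (h : (FType.arr A (FType.arrs L B)).WF) :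
    FType.arr A (FType.arrs L B) ≡ʸ FType.arrs L (FType.arr A B) :=
  arrs_append L [A] B ▸ arrs_perm (L := A :: L) (List.perm_append_singleton A L).symm h

theorem arr_one {A : FType} (hA : A.WF) : FType.arr A one ≡ʸ one := by
  have zero_arr {B : FType} (hB : B.WF) : FType.arr zero B ≡ʸ one :=
    .beta_eta (.zero_arr _) ⟨trivial, hB⟩ trivial
  calc FType.arr A one ≡ʸ FType.arr A (FType.arr zero zero) :=
        .arr (.refl hA) (zero_arr (B := zero) trivial).symm
    _ ≡ʸ FType.arr zero (FType.arr A zero) := arr_comm hA trivial trivial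
    _ ≡ʸ one := zero_arr ⟨hA, trivial⟩

theorem arrs_one {L : List FType} (hL : ∀ A ∈ L, A.WF) : FType.arrs L one ≡ʸ one := by
  induction L with
  | nil => exact .refl trivial
  | cons A L ih =>
    rw [List.forall_mem_cons] at hL
    exact (arr (refl hL.1) (ih hL.2)).trans (arr_one hL.1)

theorem alls_one (n : ℕ) : FType.alls n one ≡ʸ one := by
  induction n with
  | zero => exact .refl trivial
  | succ n ih => exact ih.all.trans (symm (.beta_eta (.all_vacuous one) trivial trivial))

theorem arr_prods (L : List FType) {B : FType} (h : (FType.arr (prods L) B).WF) :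
    FType.arr (prods L) B ≡ʸ FType.arrs L B := by
  induction L using prods.induct with
  | case1 => exact .beta_eta (.one_arr B) h h.2
  | case2 A => exact .refl h
  | case3 A A' L ih =>
    have curry : FType.arr (prods (A :: A' :: L)) B ≡ʸ
        FType.arr A (FType.arr (prods (A' :: L)) B) :=
      .beta_eta (.curry _ _ _) h ⟨h.1.1, h.1.2, h.2⟩
    exact curry.trans (.arr (.refl h.1.1) (ih ⟨h.1.2, h.2⟩))

theorem alls_of_le {A : FType} (hA : A.WF) {m n : ℕ}
    (h : ∀ i b, A.occ b i = true → i < m) (hmn : m ≤ n) :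
    FType.alls m A ≡ʸ FType.alls n A := by
  induction n, hmn using Nat.le_induction with
  | base => exact .refl (wf_alls.2 hA)
  | succ n hn ih =>
    have hshift : (FType.alls n A).shift = FType.alls n A := by
      have hskip (i : ℕ) (b : Bool) (hi : A.occ b i = true) : skip n i = i :=
        if_pos ((h i b hi).trans_le hn)
      rw [shift_alls, rename_eq_self hskip]
    have hvac := BetaEtaAx.all_vacuous (FType.alls n A)
    rw [hshift] at hvac
    exact ih.trans (.beta_eta hvac ih.wf.2 ih.wf.2)

theorem of_unfolds {A B : FType} (h : Unfolds A B) (hA : A.WF) (hB : B.WF) : A ≡ʸ B := by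
  cases h with
  | refl => exact .refl hA
  | fix s Q =>
    cases s
    · exact .beta_eta (.nu_unfold Q) hA hB
    · exact .beta_eta (.mu_unfold Q) hA hB

/-! ### Distribution of implication over products -/

theorem all_arr_self {A : FType} (hA : A.WF) :
    FType.all (FType.arr (FType.arr A.shift (var 0)) (var 0)) ≡ʸ A := by
  have hfree : A.shift.free 0 = false := free_eq_false.2 (occ_shift_zero A)
  have hinst : (var 0).inst 0 A = A := rfl
  have hax := YonedaAx.pos 0 [(0, [A.shift])] (var 0)
    (by simpa [OnlyPos] using occ_shift_zero A false) (by simp [OnlyPos, occ])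
  refine .yoneda ?_ ⟨⟨hA.rename _, trivial⟩, trivial⟩ hA
  simpa [FType.alls, FType.arrs, exs, sums, prods, muOpt, hfree, inst_zero_shift, hinst] using hax

/- Both factors `B`, `C` are traded for the premises `B ⇒ X`, `C ⇒ X` of a fresh variable `X`, as in
the Church encoding of products through sums. -/
theorem arr_prod {A B C : FType} (hA : A.WF) (hB : B.WF) (hC : C.WF) :
    FType.arr A (FType.prod B C) ≡ʸ FType.prod (FType.arr A B) (FType.arr A C) := by
  let church (D : FType) : FType := FType.arr D.shift (var 0)
  have wf_church {D : FType} (hD : D.WF) : (church D).WF := ⟨hD.rename _, trivial⟩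
  have split {E : FType} (hE : E.WF) :
      FType.all (FType.arr (FType.sum (church B) (church C)) E) ≡ʸ
        FType.prod (FType.all (FType.arr (church B) E)) (FType.all (FType.arr (church C) E)) :=
    (sum_arr (wf_church hB) (wf_church hC) hE).all.trans
      (all_prod ⟨wf_church hB, hE⟩ ⟨wf_church hC, hE⟩)
  have pull {E : FType} (hE : E.WF) :
      FType.arr A (FType.all (FType.arr E (var 0))) ≡ʸ FType.all (FType.arr E (church A)) :=
    (arr_all (B := FType.arr E (var 0)) hA ⟨hE, trivial⟩).trans
      (arr_comm (A := A.shift) (C := var 0) (hA.rename _) hE trivial).all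
  have recombine {D : FType} (hD : D.WF) :
      FType.all (FType.arr (church D) (church A)) ≡ʸ FType.arr A D :=
    (pull (wf_church hD)).symm.trans (.arr (.refl hA) (all_arr_self hD))
  calc FType.arr A (FType.prod B C) ≡ʸ
          FType.arr A (FType.all (FType.arr (FType.sum (church B) (church C)) (var 0))) :=
        .arr (.refl hA) ((split (E := var 0) trivial).trans
          (.prod (all_arr_self hB) (all_arr_self hC))).symm
    _ ≡ʸ FType.all (FType.arr (FType.sum (church B) (church C)) (church A)) :=
        pull (E := FType.sum (church B) (church C)) ⟨wf_church hB, wf_church hC⟩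
    _ ≡ʸ FType.prod (FType.arr A B) (FType.arr A C) :=
        (split (wf_church hA)).trans (.prod (recombine hB) (recombine hC))

theorem arrs_prod {L : List FType} (hL : ∀ A ∈ L, A.WF) {B C : FType} (hB : B.WF) (hC : C.WF) :
    FType.arrs L (FType.prod B C) ≡ʸ FType.prod (FType.arrs L B) (FType.arrs L C) := by
  induction L with
  | nil => exact .refl ⟨hB, hC⟩
  | cons A L ih =>
    rw [List.forall_mem_cons] at hL
    exact (arr (.refl hL.1) (ih hL.2)).trans
      (arr_prod hL.1 (wf_arrs.2 ⟨hL.2, hB⟩) (wf_arrs.2 ⟨hL.2, hC⟩))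

theorem alls_arrs_prods_eq_one (n : ℕ) {L : List FType} (hL : ∀ A ∈ L, A.WF) {M : List FType}
    (h : ∀ B ∈ M, FType.alls n (FType.arrs L B) ≡ʸ one) :
    FType.alls n (FType.arrs L (prods M)) ≡ʸ one := by
  have hwf {B : FType} (h : FType.alls n (FType.arrs L B) ≡ʸ one) : B.WF :=
    (wf_arrs.1 (wf_alls.1 h.wf.1)).2
  induction M using prods.induct with
  | case1 => exact ((arrs_one hL).alls n).trans (alls_one n)
  | case2 B => exact h B (by simp)
  | case3 B C M ih =>
    rw [List.forall_mem_cons] at h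
    have hB := hwf h.1
    have hM := hwf (ih h.2)
    calc FType.alls n (FType.arrs L (prods (B :: C :: M))) ≡ʸ _ :=
          (arrs_prod hL hB hM).alls n
      _ ≡ʸ _ := alls_prod n (wf_arrs.2 ⟨hL, hB⟩) (wf_arrs.2 ⟨hL, hM⟩)
      _ ≡ʸ FType.prod one one := .prod h.1 (ih h.2)
      _ ≡ʸ one := .beta_eta (.prod_one one) ⟨trivial, trivial⟩ trivial

end YonedaEquiv

/-! ### Elimination of quantified variables -/

namespace FType

/-- The premise `P ⇒ X` (for `s = true`) or `X ⇒ P` (for `s = false`), given by the pair of the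
index of `X` and of `P`, to which the schema of Yoneda isomorphisms with the same sign applies. -/
def clause (s : Bool) (p : ℕ × FType) : FType :=
  if s then arr p.2 (var p.1) else arr (var p.1) p.2

theorem occ_clause (s : Bool) (p : ℕ × FType) (i : ℕ) :
    (clause s p).occ s i = (p.2.occ false i || decide (i = p.1)) := by
  cases s <;> simp [clause, occ, Bool.or_comm]

theorem WF.clause {p : ℕ × FType} (h : p.2.WF) (s : Bool) : (clause s p).WF := by
  cases s
  · exact ⟨trivial, h⟩
  · exact ⟨h, trivial⟩

theorem subst_clause (s : Bool) (p : ℕ × FType) {σ : ℕ → FType} (h : σ p.1 = var p.1) :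
    (clause s p).subst σ = clause s (p.1, p.2.subst σ) := by
  cases s <;> simp [clause, subst, h]

end FType

namespace YonedaEquiv

open FType

theorem alls_repl {i n : ℕ} (hi : i < n) {A B T : FType}
    (h : FType.all (FType.alls i A) ≡ʸ FType.alls i (B.inst i T)) :
    FType.alls n A ≡ʸ FType.alls n (repl i (T.rename (skip i)) B) := by
  obtain ⟨m, rfl⟩ : ∃ m, n = m + 1 + i := ⟨n - (1 + i), by omega⟩
  have hvac := BetaEtaAx.all_vacuous (FType.alls i (B.inst i T))
  rw [shift_alls, rename_skip_inst] at hvac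
  have hwf : (repl i (T.rename (skip i)) B).WF :=
    rename_skip_inst B i T ▸ (wf_alls.1 h.wf.2).rename _
  rw [alls_add, alls_add m 1, alls_add, alls_add m 1]
  exact (h.trans (.beta_eta hvac h.wf.2 (wf_alls (n := i).2 hwf))).alls m

theorem alls_arr_clause (s : Bool) {i n : ℕ} (hi : i < n) {P B : FType} (hP : P.WF)
    (hPi : OnlyPos i P) (hB : B.WF) (hBi : B.occ (!s) i = false) :
    FType.alls n (FType.arr (clause s (i, P)) B) ≡ʸ FType.alls n (repl i (fixAt s i P) B) := by
  have hfix := hP.fixOpt hPi s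
  rw [← rename_skip_fixOpt]
  have hclause : (clause s (i, P)).WF := WF.clause (p := (i, P)) hP s
  refine alls_repl hi (.yoneda ?_ (wf_alls.2 ⟨hclause, hB⟩) (wf_alls.2 (hB.inst hfix i)))
  cases s
  · simpa [clause, FType.alls, FType.arrs, prods] using
      YonedaAx.neg i [(0, P)] B (by simpa using hPi) hBi
  · simpa [clause, FType.alls, FType.arrs, prods, exs, sums] using
      YonedaAx.pos i [(0, [P])] B (by simpa using hPi) hBi

theorem alls_arrs_clauses (s : Bool) {n : ℕ} {Z : List (ℕ × FType)} (hZ : IsSystem Z)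
    (hn : ∀ p ∈ Z, p.1 < n) {B : FType} (hB : B.WF) (hBZ : ∀ p ∈ Z, B.occ (!s) p.1 = false) :
    FType.alls n (FType.arrs (Z.map (clause s)) B) ≡ʸ FType.alls n (B.subst (solve s Z)) := by
  induction Z generalizing B with
  | nil =>
    rw [solve, subst_var]
    exact .refl (wf_alls.2 hB)
  | cons p Z ih =>
    obtain ⟨hp, hn⟩ := List.forall_mem_cons.1 hn
    obtain ⟨hBp, hBZ⟩ := List.forall_mem_cons.1 hBZ
    have hkey := (List.nodup_cons.1 hZ.nodup).1
    have hP : ∀ q ∈ Z, OnlyPos q.1 p.2 := fun q hq => hZ.onlyPos p (.head Z) q (.tail p hq)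
    have hZp : ∀ q ∈ Z, OnlyPos p.1 q.2 := fun q hq => hZ.onlyPos q (.tail p hq) p (.head Z)
    have hwf := hZ.wf p (.head Z)
    have hB' : ∀ q ∈ Z, (FType.arr (clause s p) B).occ (!s) q.1 = false := by
      intro q hq
      have hne : q.1 ≠ p.1 := fun e => hkey (e ▸ List.mem_map_of_mem hq)
      simp [occ, occ_clause, show p.2.occ false q.1 = false from hP q hq, hne, hBZ q hq]
    have hC : ∀ A ∈ Z.map (clause s), A.WF :=
      List.forall_mem_map.2 fun q hq => (hZ.tail.wf q hq).clause s
    have hpB : (FType.arr (clause s p) B).WF := ⟨hwf.clause s, hB⟩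
    calc FType.alls n (FType.arrs ((p :: Z).map (clause s)) B)
        ≡ʸ FType.alls n (FType.arrs (Z.map (clause s)) (FType.arr (clause s p) B)) :=
          (arr_arrs_comm ⟨hwf.clause s, wf_arrs.2 ⟨hC, hB⟩⟩).alls n
      _ ≡ʸ FType.alls n ((FType.arr (clause s p) B).subst (solve s Z)) :=
          ih hZ.tail hn hpB hB'
      _ = FType.alls n (FType.arr (clause s (p.1, p.2.subst (solve s Z)))
            (B.subst (solve s Z))) := by
          rw [subst, subst_clause s p (solve_of_notMem hkey)]
      _ ≡ʸ FType.alls n (B.subst (solve s (p :: Z))) := by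
          rw [subst_solve_cons]
          exact alls_arr_clause s hp (hwf.subst (hZ.tail.wf_solve s))
            (hZ.tail.onlyPos_subst_solve s hP hZp (hZ.onlyPos p (.head Z) p (.head Z)))
            (hB.subst (hZ.tail.wf_solve s)) (hZ.tail.onlyPos_subst_solve s hBZ hZp hBp)

theorem alls_arrs_vars_eq_one {n i : ℕ} {L : List ℕ} (hL : L.Nodup) (hiL : i ∈ L) (hi : i < n) :
    FType.alls n (FType.arrs (L.map var) (var i)) ≡ʸ one := by
  let B : FType := FType.arrs ((L.erase i).map var) (var i)
  have hB : B.WF := wf_arrs.2 ⟨List.forall_mem_map.2 fun _ _ => trivial, trivial⟩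
  have hvars : ∀ A ∈ L.map var, A.WF := List.forall_mem_map.2 fun _ _ => trivial
  have hBi : B.occ false i = false := by
    rw [← Bool.not_eq_true, occ_arrs]
    simp [occ, hL.mem_erase_iff]
  have hperm : (L.map var).Perm (var i :: (L.erase i).map var) :=
    (List.perm_cons_erase hiL).map var
  have hrepl : repl i (fixAt true i one) B ≡ʸ one := by
    rw [repl, subst_arrs, subst, Function.update_self]
    refine arrs_one (List.forall_mem_map.2 (List.forall_mem_map.2 fun j _ => ?_))
    exact WF.repl (A := var j) (T := one) trivial trivial i
  calc FType.alls n (FType.arrs (L.map var) (var i)) ≡ʸ FType.alls n (FType.arr (var i) B) :=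
        (arrs_perm (B := var i) hperm (wf_arrs.2 ⟨hvars, trivial⟩)).alls n
    _ ≡ʸ FType.alls n (FType.arr (clause true (i, one)) B) :=
        (arr (symm (.beta_eta (.one_arr (var i)) ⟨trivial, trivial⟩ trivial)) (.refl hB)).alls n
    _ ≡ʸ FType.alls n (repl i (fixAt true i one) B) :=
        alls_arr_clause true hi trivial rfl hB hBi
    _ ≡ʸ one := (hrepl.alls n).trans (alls_one n)

end YonedaEquiv

namespace SType

/-! ### Premises of simple types -/

/-- The variable `X` in which a simple type `A₁ ⇒ … ⇒ Aₖ ⇒ X` ends. -/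
def head : SType → ℕ
  | var i => i
  | arr _ B => B.head

/-- The premises `A₁, …, Aₖ` of a simple type `A₁ ⇒ … ⇒ Aₖ ⇒ X`. -/
def premises : SType → List SType
  | var _ => []
  | arr A B => A :: B.premises

/-- The hereditary premises of a simple type, that is its premises, their premises, and so on,
listed according to the sign with which they stand in the type: the premises themselves are
negative, their premises are positive. -/
def subpremises : SType → Bool → List SType
  | var _, _ => []
  | arr A B, true => A.subpremises false ++ B.subpremises true
  | arr A B, false => A :: (A.subpremises true ++ B.subpremises false)

theorem subpremises_perm (A : SType) :
    (A.subpremises true).Perm ((A.subpremises false).flatMap premises) ∧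
      (A.subpremises false).Perm ((A :: A.subpremises true).flatMap premises) := by
  induction A with
  | var i => exact ⟨.nil, .nil⟩
  | arr A B ihA ihB =>
    constructor
    · simpa [subpremises] using ihA.2.append ihB.1
    · rw [subpremises, List.flatMap_cons, List.flatMap_append]
      refine .cons A ((ihA.1.append ihB.2).trans ?_)
      exact List.perm_append_comm_assoc _ B.premises _

theorem mem_subpremises_true {A F L : SType} (hF : F ∈ A.subpremises false)
    (hL : L ∈ F.premises) : L ∈ A.subpremises true :=
  A.subpremises_perm.1.mem_iff.2 (List.mem_flatMap.2 ⟨F, hF, hL⟩)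

theorem mem_subpremises_false {A B F : SType} (hB : B ∈ A :: A.subpremises true)
    (hF : F ∈ B.premises) : F ∈ A.subpremises false :=
  A.subpremises_perm.2.mem_iff.2 (List.mem_flatMap.2 ⟨B, hB, hF⟩)

theorem occurs_head (A : SType) : A.Occurs A.head := by
  induction A with
  | var i => exact rfl
  | arr A B _ ihB => exact .inr ihB

theorem occurs_head_of_mem_subpremises {A F : SType} {b : Bool} (hF : F ∈ A.subpremises b) :
    Occurs F.head A := by
  induction A generalizing b with
  | var i => simp [subpremises] at hF
  | arr A B ihA ihB =>
    cases b <;> simp only [subpremises, List.mem_cons, List.mem_append] at hF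
    · rcases hF with rfl | hF | hF
      exacts [.inl (occurs_head F), .inl (ihA hF), .inr (ihB hF)]
    · exact hF.imp ihA ihB

theorem count_eq (A : SType) (b : Bool) (i : ℕ) :
    A.count b i =
      ((A.subpremises b).map head).count i + if b = true ∧ i = A.head then 1 else 0 := by
  induction A generalizing b with
  | var j => simp [count, subpremises, head]; rfl
  | arr A B ihA ihB =>
    cases b
    · simp only [count, subpremises, head, ihA, ihB, List.map_cons, List.map_append,
        List.count_cons, List.count_append, beq_iff_eq, eq_comm (a := A.head)]
      simp; omega
    · simp [count, subpremises, head, ihA, ihB, Nat.add_assoc]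

theorem NegNonDup.nodup_head {A : SType} (h : A.NegNonDup) :
    ((A.subpremises false).map head).Nodup :=
  List.nodup_iff_count_le_one.2 fun i => by simpa [count_eq] using h i

theorem Balanced.negNonDup {A : SType} (h : A.Balanced) : A.NegNonDup := by
  have count_eq_zero (B : SType) (b : Bool) (i : ℕ) (hi : ¬ Occurs i B) : B.count b i = 0 := by
    induction B generalizing b with
    | var j => simp_all [count, Occurs]
    | arr A B ihA ihB =>
      rw [Occurs, not_or] at hi
      rw [count, ihA _ hi.1, ihB _ hi.2]
  intro i
  by_cases hi : Occurs i A
  · exact (h i hi).2.le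
  · exact (count_eq_zero A false i hi).trans_le zero_le_one

theorem occurs_of_occ_toFType {A : SType} {b : Bool} {i : ℕ}
    (h : A.toFType.occ b i = true) : Occurs i A := by
  induction A generalizing b with
  | var j => simp_all [toFType, FType.occ, Occurs]
  | arr A B ihA ihB => exact (Bool.or_eq_true _ _ ▸ h).imp ihA ihB

theorem wf_toFType (A : SType) : A.toFType.WF := by
  induction A with
  | var _ => trivial
  | arr A B ihA ihB => exact ⟨ihA, ihB⟩

/-! ### Normal proofs -/

/-- Provability by long normal forms: `B` is proved by introducing all its premises and then
eliminating an assumption `F` with the same head. -/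
inductive Prov : List SType → SType → Prop
  | intro {Γ : List SType} {F B : SType} (hF : F ∈ B.premises ++ Γ) (hhead : F.head = B.head)
      (hprem : ∀ L ∈ F.premises, Prov (B.premises ++ Γ) L) : Prov Γ B

theorem Prov.mono {Γ Δ : List SType} {B : SType} (h : Prov Γ B) (hs : Γ ⊆ Δ) : Prov Δ B := by
  induction h generalizing Δ with
  | @intro Γ F B hF hhead _ ih =>
    have hs' : B.premises ++ Γ ⊆ B.premises ++ Δ := by grind
    exact .intro (hs' hF) hhead fun L hL => ih L hL hs'

theorem Prov.arr {Γ : List SType} {A B : SType} (h : Prov (A :: Γ) B) : Prov Γ (arr A B) := by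
  obtain ⟨hF, hhead, hprem⟩ := h
  have hs : B.premises ++ A :: Γ ⊆ (SType.arr A B).premises ++ Γ :=
    List.perm_middle.subset
  exact .intro (hs hF) hhead fun L hL => (hprem L hL).mono hs

/-- Forcing in the Kripke model whose worlds are the lists of assumptions. -/
def Forces : List SType → SType → Prop
  | Γ, var i => Prov Γ (var i)
  | Γ, arr A B => ∀ Δ, Γ ⊆ Δ → Forces Δ A → Forces Δ B

theorem Forces.mono {Γ Δ : List SType} {A : SType} (h : Forces Γ A) (hs : Γ ⊆ Δ) :
    Forces Δ A := by
  cases A with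
  | var i => exact Prov.mono h hs
  | arr A B => exact fun Θ hΘ => h Θ (List.Subset.trans hs hΘ)

theorem reify_and_reflect (A : SType) :
    (∀ Γ, Forces Γ A → Prov Γ A) ∧
      ∀ Γ F L, F ∈ Γ → F.premises = L ++ A.premises → F.head = A.head →
        (∀ B ∈ L, Prov Γ B) → Forces Γ A := by
  induction A with
  | var i =>
    refine ⟨fun Γ h => h, fun Γ F L hF hprem hhead hL => .intro hF hhead ?_⟩
    rwa [hprem, premises, List.append_nil]
  | arr A B ihA ihB =>
    constructor
    · intro Γ h
      have hA : Forces (A :: Γ) A := ihA.2 _ A [] List.mem_cons_self rfl rfl (by simp)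
      exact (ihB.1 _ (h _ (List.subset_cons_self _ _) hA)).arr
    · intro Γ F L hF hprem hhead hL Δ hs hA
      refine ihB.2 Δ F (L ++ [A]) (hs hF) (by simpa [premises] using hprem) hhead ?_
      simpa [or_imp, forall_and] using ⟨fun B hB => (hL B hB).mono hs, ihA.1 Δ hA⟩

theorem forces_of_hasType {Γ Δ : List SType} {t : STerm} {A : SType} (h : STerm.HasType Γ t A)
    (hΔ : ∀ B ∈ Γ, Forces Δ B) : Forces Δ A := by
  induction h generalizing Δ with
  | var hx => exact hΔ _ (List.mem_of_getElem? hx)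
  | lam _ ih =>
    exact fun Θ hs hA => ih (List.forall_mem_cons.2 ⟨hA, fun B hB => (hΔ B hB).mono hs⟩)
  | app _ _ iht ihu => exact iht hΔ Δ (List.Subset.refl _) (ihu hΔ)

theorem IsInhabited.prov {A : SType} (h : A.IsInhabited) : Prov [] A := by
  obtain ⟨t, ht⟩ := h
  exact (reify_and_reflect A).1 _ (forces_of_hasType ht (by simp))

/-- A proof of the goal `z` eliminates a premise whose own premises have `y` among their heads. -/
def DependsOn (A : SType) (y z : ℕ) : Prop :=
  ∃ F ∈ A.subpremises false, F.head = z ∧ ∃ L ∈ F.premises, L.head = y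

theorem Prov.acc_dependsOn {A B : SType} {Γ : List SType} (h : Prov Γ B)
    (hA : ((A.subpremises false).map head).Nodup) (hΓ : Γ ⊆ A.subpremises false)
    (hB : B ∈ A :: A.subpremises true) : Acc A.DependsOn B.head := by
  induction h with
  | @intro Γ F B hF hhead _ ih =>
    have hBΓ : B.premises ++ Γ ⊆ A.subpremises false :=
      List.append_subset.2 ⟨fun G => mem_subpremises_false hB, hΓ⟩
    refine .intro _ ?_
    rintro _ ⟨G, hG, hGhead, L, hL, rfl⟩
    obtain rfl : G = F := List.inj_on_of_nodup_map hA hG (hBΓ hF) (hGhead.trans hhead.symm)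
    exact ih L hL hBΓ (.tail _ (mem_subpremises_true hG hL))

theorem Prov.not_transGen_dependsOn {A B : SType} {Γ : List SType} (h : Prov Γ B)
    (hA : ((A.subpremises false).map head).Nodup) (hΓ : Γ ⊆ A.subpremises false)
    (hB : B ∈ A :: A.subpremises true) : ¬ Relation.TransGen A.DependsOn B.head B.head :=
  (h.acc_dependsOn hA hΓ hB).transGen.rec
    (motive := fun z _ => ¬ Relation.TransGen A.DependsOn z z) fun z _ ih hz => ih z hz hz

end SType

namespace SType

open FType YonedaEquiv

/-! ### Coding of hereditary premises by variables -/

/-- The variable `c_F` that stands for the hereditary premise `F`. It is fresh if all variables are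
below `n`, and it determines `F` among premises with distinct heads. -/
def code (n : ℕ) (F : SType) : FType := .var (n + F.head)

/-- The type `L` with its premises replaced by the variables that stand for them. -/
def goal (n : ℕ) (L : SType) : FType := arrs (L.premises.map (code n)) (.var L.head)

/-- The type `F` with the premises of its premises replaced by the variables that stand for
them. -/
def body (n : ℕ) (F : SType) : FType := arrs (F.premises.map (goal n)) (.var F.head)

theorem wf_goal (n : ℕ) (L : SType) : (goal n L).WF :=
  wf_arrs.2 ⟨List.forall_mem_map.2 fun _ _ => trivial, trivial⟩

theorem wf_body (n : ℕ) (F : SType) : (body n F).WF :=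
  wf_arrs.2 ⟨List.forall_mem_map.2 fun L _ => wf_goal n L, trivial⟩

theorem occ_goal_true {n i : ℕ} {L : SType} : (goal n L).occ true i = true ↔ i = L.head := by
  rw [goal, occ_arrs]
  simp [code, occ]

theorem occ_goal_false {n i : ℕ} {L : SType} :
    (goal n L).occ false i = true ↔ ∃ F ∈ L.premises, i = n + F.head := by
  rw [goal, occ_arrs]
  simp [code, occ]

theorem occ_body_false {n i : ℕ} {F : SType} :
    (body n F).occ false i = true ↔ ∃ L ∈ F.premises, i = L.head := by
  rw [body, occ_arrs]
  simp [occ, occ_goal_true]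

theorem subst_goal {n : ℕ} {L : SType} {σ : ℕ → FType}
    (hσ : ∀ F ∈ L.premises, σ (n + F.head) = code n F) :
    (goal n L).subst σ = arrs (L.premises.map (code n)) (σ L.head) := by
  rw [goal, subst_arrs, List.map_map]
  exact congrArg (FType.arrs · _) (List.map_congr_left hσ)

theorem subst_goal_and_body {n : ℕ} (C : SType) {σ : ℕ → FType}
    (hvar : ∀ i, Occurs i C → σ i = .var i) :
    ((∀ F ∈ C.subpremises false, σ (n + F.head) ≡ʸ (body n F).subst σ) →
      (goal n C).subst σ ≡ʸ C.toFType) ∧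
    ((∀ F ∈ C.subpremises true, σ (n + F.head) ≡ʸ (body n F).subst σ) →
      (body n C).subst σ ≡ʸ C.toFType) := by
  induction C with
  | var i =>
    have h : σ i ≡ʸ .var i := hvar i rfl ▸ .refl (A := .var i) trivial
    exact ⟨fun _ => h, fun _ => h⟩
  | arr A B ihA ihB =>
    have ihA := ihA fun i hi => hvar i (.inl hi)
    have ihB := ihB fun i hi => hvar i (.inr hi)
    simp only [subpremises, List.forall_mem_cons, List.forall_mem_append]
    exact ⟨fun h => .arr (h.1.trans (ihA.2 h.2.1)) (ihB.1 h.2.2),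
      fun h => .arr (ihA.1 h.1) (ihB.2 h.2)⟩

section

variable {n : ℕ} {A : SType}

/-- The variables that stand for the negative hereditary premises of `A`, as a system to be solved
by greatest fixpoints. -/
def codeSystem (n : ℕ) (A : SType) : List (ℕ × FType) :=
  (A.subpremises false).map fun F => (n + F.head, body n F)

/-- The heads of the negative hereditary premises of `A`, as a system to be solved by least
fixpoints: the head of `F` stands for the conjunction of `F` itself and its premises. -/
def headSystem (n : ℕ) (A : SType) : List (ℕ × FType) :=
  (A.subpremises false).map fun F => (F.head, prods (code n F :: F.premises.map (goal n)))

theorem isSystem_codeSystem (hn : ∀ i, Occurs i A → i < n)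
    (hA : ((A.subpremises false).map head).Nodup) : IsSystem (codeSystem n A) where
  nodup := by
    simpa [codeSystem, Function.comp_def] using hA.map (add_right_injective n)
  wf := List.forall_mem_map.2 fun F _ => wf_body n F
  onlyPos := by
    refine List.forall_mem_map.2 fun F hF => List.forall_mem_map.2 fun G _ => ?_
    rw [OnlyPos, ← Bool.not_eq_true, occ_body_false]
    rintro ⟨L, hL, h⟩
    have := hn _ (occurs_head_of_mem_subpremises (mem_subpremises_true hF hL))
    omega

theorem isSystem_headSystem (hn : ∀ i, Occurs i A → i < n)
    (hA : ((A.subpremises false).map head).Nodup) : IsSystem (headSystem n A) where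
  nodup := by simpa [headSystem, Function.comp_def] using hA
  wf := List.forall_mem_map.2 fun F _ => wf_prods.2 <|
    List.forall_mem_cons.2 ⟨trivial, List.forall_mem_map.2 fun L _ => wf_goal n L⟩
  onlyPos := by
    refine List.forall_mem_map.2 fun F _ => List.forall_mem_map.2 fun G hG => ?_
    have := hn _ (occurs_head_of_mem_subpremises hG)
    rw [OnlyPos, ← Bool.not_eq_true, occ_prods]
    simp [code, occ, occ_goal_false]
    omega

theorem alls_arrs_codeSystem (hn : ∀ i, Occurs i A → i < n)
    (hA : ((A.subpremises false).map head).Nodup) :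
    alls (n + n) (arrs ((codeSystem n A).map (clause false)) (goal n A)) ≡ʸ
      alls (n + n) A.toFType := by
  have hZ := isSystem_codeSystem hn hA
  have hlt {F : SType} (hF : F ∈ A.subpremises false) : F.head < n :=
    hn _ (occurs_head_of_mem_subpremises hF)
  have hvar (i : ℕ) (hi : Occurs i A) : solve false (codeSystem n A) i = .var i := by
    refine solve_of_notMem ?_
    have := hn i hi
    simp [codeSystem]
    omega
  have hunfold : ∀ F ∈ A.subpremises false, solve false (codeSystem n A) (n + F.head) ≡ʸ
      (body n F).subst (solve false (codeSystem n A)) := fun F hF =>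
    of_unfolds (hZ.unfolds_solve false (List.mem_map_of_mem hF)) (hZ.wf_solve false _)
      ((wf_body n F).subst (hZ.wf_solve false))
  refine (alls_arrs_clauses false hZ ?_ (wf_goal n A) ?_).trans
    (((subst_goal_and_body A hvar).1 hunfold).alls _)
  · exact List.forall_mem_map.2 fun F hF => Nat.add_lt_add_left (hlt hF) n
  · refine List.forall_mem_map.2 fun F _ => ?_
    have := hn _ A.occurs_head
    rw [← Bool.not_eq_true, Bool.not_false, occ_goal_true]
    omega

theorem alls_arrs_headSystem (hn : ∀ i, Occurs i A → i < n)
    (hA : ((A.subpremises false).map head).Nodup) :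
    alls (n + n) (arrs ((headSystem n A).map (clause true)) (goal n A)) ≡ʸ
      alls (n + n) ((goal n A).subst (solve true (headSystem n A))) := by
  have hlt {F : SType} (hF : F ∈ A.subpremises false) : F.head < n :=
    hn _ (occurs_head_of_mem_subpremises hF)
  refine alls_arrs_clauses true (isSystem_headSystem hn hA) ?_ (wf_goal n A) ?_
  · exact List.forall_mem_map.2 fun F hF => (hlt hF).trans_le (Nat.le_add_left n n)
  · refine List.forall_mem_map.2 fun F hF => ?_
    have := hlt hF
    rw [← Bool.not_eq_true, Bool.not_true, occ_goal_false]
    rintro ⟨G, -, h⟩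
    omega

/- The clause `c_F ⇒ F'` for `c_F` is, after uncurrying, also a clause for the head of `F`. -/
theorem arrs_codeSystem_equiv_arrs_headSystem (n : ℕ) (A : SType) :
    arrs ((codeSystem n A).map (clause false)) (goal n A) ≡ʸ
      arrs ((headSystem n A).map (clause true)) (goal n A) := by
  refine YonedaEquiv.arrs ?_ (.refl (wf_goal n A))
  simp only [codeSystem, headSystem, List.forall₂_map_left_iff, List.forall₂_map_right_iff,
    List.forall₂_same]
  refine fun F _ => symm (arr_prods (code n F :: F.premises.map (goal n)) ⟨wf_prods.2 ?_, trivial⟩)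
  exact List.forall_mem_cons.2 ⟨trivial, List.forall_mem_map.2 fun L _ => wf_goal n L⟩

theorem alls_toFType_equiv (hn : ∀ i, Occurs i A → i < n)
    (hA : ((A.subpremises false).map head).Nodup) :
    alls n A.toFType ≡ʸ alls (n + n) ((goal n A).subst (solve true (headSystem n A))) :=
  calc alls n A.toFType ≡ʸ alls (n + n) A.toFType :=
        alls_of_le A.wf_toFType (fun i _ h => hn i (occurs_of_occ_toFType h)) (Nat.le_add_left n n)
    _ ≡ʸ alls (n + n) (arrs ((codeSystem n A).map (clause false)) (goal n A)) :=
        (alls_arrs_codeSystem hn hA).symm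
    _ ≡ʸ alls (n + n) (arrs ((headSystem n A).map (clause true)) (goal n A)) :=
        (arrs_codeSystem_equiv_arrs_headSystem n A).alls _
    _ ≡ʸ alls (n + n) ((goal n A).subst (solve true (headSystem n A))) :=
        alls_arrs_headSystem hn hA

theorem solve_headSystem_code (hn : ∀ i, Occurs i A → i < n) (F : SType) :
    solve true (headSystem n A) (n + F.head) = code n F := by
  refine solve_of_notMem fun h => ?_
  obtain ⟨G, hG, e⟩ : ∃ G ∈ A.subpremises false, G.head = n + F.head := by
    simpa [headSystem] using h
  have := hn _ (occurs_head_of_mem_subpremises hG)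
  omega

theorem solve_headSystem_head (hn : ∀ i, Occurs i A → i < n)
    (hA : ((A.subpremises false).map head).Nodup) {F : SType} (hF : F ∈ A.subpremises false) :
    solve true (headSystem n A) F.head ≡ʸ
      prods (code n F ::
        F.premises.map fun L => (goal n L).subst (solve true (headSystem n A))) := by
  have hZ := isSystem_headSystem hn hA
  have hp := List.mem_map_of_mem
    (f := fun F => (F.head, prods (code n F :: F.premises.map (goal n)))) hF
  have h := of_unfolds (hZ.unfolds_solve true hp) (hZ.wf_solve true _)
    ((hZ.wf _ hp).subst (hZ.wf_solve true))
  rw [subst_prods, List.map_cons, List.map_map] at h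
  exact (solve_headSystem_code hn F) ▸ h

theorem nodup_head_flatMap_premises (hA : ((A.subpremises false).map head).Nodup) {S : List SType}
    (hS : S.Nodup) (hSA : S ⊆ A :: A.subpremises true) :
    ((S.flatMap premises).map head).Nodup := by
  obtain ⟨S', hS', hsub⟩ := List.subperm_of_subset hS hSA
  have hperm := (hS'.flatMap_right premises).map head
  have hnodup := (A.subpremises_perm.2.map head).nodup_iff.1 hA
  exact hperm.nodup_iff.1 (hnodup.sublist ((hsub.flatMap premises).map head))

theorem alls_arrs_codes_code_eq_one {Γ : List SType} (hΓ : (Γ.map head).Nodup) {F : SType}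
    (hF : F ∈ Γ) (hFn : F.head < n) :
    alls (n + n) (arrs (Γ.map (code n)) (code n F)) ≡ʸ one := by
  have hmem := List.mem_map_of_mem (f := (n + ·)) (List.mem_map_of_mem (f := head) hF)
  have h := alls_arrs_vars_eq_one (hΓ.map (add_right_injective n)) hmem
    (Nat.add_lt_add_left hFn n)
  rw [List.map_map, List.map_map] at h
  exact h

/- `S` is the branch of goals below `B` in the proof, so that the assumptions available to `B` are
the premises of the goals in `S`. No goal is repeated on it because the dependency of heads is
acyclic, so no variable standing for an assumption occurs twice among the premises. -/
theorem alls_arrs_codes_eq_one (hn : ∀ i, Occurs i A → i < n)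
    (hA : ((A.subpremises false).map head).Nodup) {Γ : List SType} {B : SType} (h : Prov Γ B)
    {S : List SType} (hΓ : Γ = S.flatMap premises) (hS : (B :: S).Nodup)
    (hSA : B :: S ⊆ A :: A.subpremises true)
    (hdep : ∀ C ∈ S, Relation.TransGen A.DependsOn B.head C.head) :
    alls (n + n) (arrs (((B :: S).flatMap premises).map (code n))
      (solve true (headSystem n A) B.head)) ≡ʸ one := by
  induction h generalizing S with
  | @intro Γ F B hF hhead hprem ih =>
    subst hΓ
    have hΓA : (B :: S).flatMap premises ⊆ A.subpremises false := fun G hG =>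
      let ⟨C, hC, hGC⟩ := List.mem_flatMap.1 hG
      mem_subpremises_false (hSA hC) hGC
    have hFA := hΓA hF
    have hcodes : ∀ C ∈ ((B :: S).flatMap premises).map (code n), C.WF :=
      List.forall_mem_map.2 fun _ _ => trivial
    have hrefl := List.forall₂_same.2 fun C hC => YonedaEquiv.refl (hcodes C hC)
    rw [← hhead]
    refine ((YonedaEquiv.arrs hrefl (solve_headSystem_head hn hA hFA)).alls _).trans ?_
    refine alls_arrs_prods_eq_one _ hcodes (List.forall_mem_cons.2 ⟨?_, ?_⟩)
    · exact alls_arrs_codes_code_eq_one (nodup_head_flatMap_premises hA hS hSA) hF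
        (hn _ (occurs_head_of_mem_subpremises hFA))
    · refine List.forall_mem_map.2 fun L hL => ?_
      have hLA := mem_subpremises_true hFA hL
      have hLB : A.DependsOn L.head B.head := ⟨F, hFA, hhead, L, hL, rfl⟩
      have hLS : ∀ C ∈ B :: S, Relation.TransGen A.DependsOn L.head C.head :=
        List.forall_mem_cons.2 ⟨.single hLB, fun C hC => .head hLB (hdep C hC)⟩
      have hnotMem : L ∉ B :: S := fun hmem =>
        (hprem L hL).not_transGen_dependsOn hA hΓA (.tail A hLA) (hLS L hmem)
      have ih := ih L hL rfl (List.nodup_cons.2 ⟨hnotMem, hS⟩)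
        (List.cons_subset.2 ⟨.tail A hLA, hSA⟩) hLS
      rw [subst_goal fun G _ => solve_headSystem_code hn G, ← arrs_append, ← List.map_append]
      exact ((arrs_perm (List.perm_append_comm.map _) (wf_alls.1 ih.wf.1)).alls _).symm.trans ih

end

end SType

theorem proposition1 (n : ℕ) (A : SType)
    (hfree : ∀ i, SType.Occurs i A → i < n)
    (hinh : A.IsInhabited)
    (hA : A.Balanced ∨ A.NegNonDup) :
    YonedaEquiv (FType.alls n A.toFType) FType.one := by
  have hheads : ((A.subpremises false).map SType.head).Nodup :=
    (hA.elim SType.Balanced.negNonDup id).nodup_head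
  refine (SType.alls_toFType_equiv hfree hheads).trans ?_
  rw [SType.subst_goal fun F _ => SType.solve_headSystem_code hfree F]
  have h := SType.alls_arrs_codes_eq_one hfree hheads hinh.prov (S := []) rfl
    (List.nodup_singleton A) (by simp) (by simp)
  simpa using h
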